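/- Let $d\ge 1$. A \emph{curve} is a finite sequence of distinct points (vertices) of $\mathbb Z^d$ in which any two consecutive vertices are at distance $1$, i.e. form an edge; the \emph{axis} of an edge is the coordinate $j\in\{1,\dots,d\}$ in which its two ends differ, its \emph{direction} is $j$ or $-j$ according to the sign of the change. A \emph{free curve} is a sequence of directions (a curve up to translation); its reverse is obtained by reversing the order and negating all directions. The free curve $G(d)$ (binary reflected Gray code) is defined recursively: $G(0)$ is empty, and $G(d)$ is $G(d-1)$, followed by $\langle d\rangle$, followed by the reverse of $G(d-1)$. An \emph{isometric image} of $G(d)$ is a curve obtained from $G(d)$ by a signed permutation of the directions and a translation, possibly followed by reversal. A curve $B$ is obtained by \emph{inflating} a curve $A=(v_1,\dots,v_m)$ if $B$ is the concatenation of curves $C_1,\dots,C_m$, where $C_i$ visits exactly the points of $2v_i+\{0,1\}^d$. A curve is \emph{well-folded} if it is a single vertex, or is obtained by inflating a well-folded curve with all the $C_i$ isometric images of $G(d)$. A curve is \emph{hyperorthogonal} if, for every integer $n$ with $0\le n\le d-2$, each sequence of $2^n$ consecutive edges of it has exactly $n+1$ different axes. Let $f:[0,1]\to[0,1]^d$ be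 a $d$-dimensional space-filling curve (continuous and surjective) approximated by curves $A_0,A_1,A_2,\dots$; that is, $A_0$ is the single vertex $0$, each $A_{k+1}$ is obtained by inflating $A_k$, and if $v_{k,1},\dots,v_{k,2^{dk}}$ are the vertices of $A_k$ in order, then for all $k\ge0$ and $1\le i\le 2^{dk}$ the curve $f$ maps the interval $\left[\frac{i-1}{2^{dk}},\frac{i}{2^{dk}}\right]$ onto the cube $H_{k,i}=2^{-k}\left(v_{k,i}+[0,1]^d\right)$. We call $f$ well-folded, respectively hyperorthogonal, if all the $A_k$ are. \textbf{Theorem.} If $f$ is well-folded and hyperorthogonal, then for all $0\le a<b\le 1$ the section $f([a,b])$ has positive $d$-dimensional Lebesgue measure, and its box-to-curve ratio, i.e. the volume of the smallest axis-aligned box that contains $f([a,b])$ divided by the Lebesgue measure of $f([a,b])$, is at most $4$. -/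

import Mathlib

open Set MeasureTheory

namespace GridCurve

/-- A vertex of the `d`-dimensional integer grid. -/
abbrev Vertex (d : ℕ) := Fin d → ℤ

/-- A direction: an axis together with a sign (the axes `1, …, d` are indexed by `Fin d`). -/
abbrev Direction (d : ℕ) := Fin d × ℤˣ

/-- The unit vector that points in a given direction. -/
def Direction.vec {d : ℕ} (e : Direction d) : Vertex d := Pi.single e.1 (e.2 : ℤ)

/-- The ordered pair `(v, w)` is an edge of the grid: the two points are at distance one,
that is, `w - v` is the unit vector of some direction. -/
def IsEdge {d : ℕ} (v w : Vertex d) : Prop := ∃ e : Direction d, w = v + e.vec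

/-- A curve on the grid: a sequence of distinct vertices, each two subsequent ones forming
an edge. -/
def IsCurve {d : ℕ} (C : List (Vertex d)) : Prop := C.Nodup ∧ C.IsChain IsEdge

/-! ### Free curves and the binary reflected Gray code -/

/-- A free curve is given by the directions of its edges only. -/
abbrev FreeCurve (d : ℕ) := List (Direction d)

/-- The reverse of a free curve: the order is reversed and all directions are negated. -/
def FreeCurve.rev {d : ℕ} (C : FreeCurve d) : FreeCurve d :=
  (List.reverse C).map fun e => (e.1, -e.2)

/-- A free curve in dimension `d`, regarded as a free curve in dimension `d + 1` that does not
use the last axis. -/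
def FreeCurve.lift {d : ℕ} (C : FreeCurve d) : FreeCurve (d + 1) :=
  List.map (fun e => (e.1.castSucc, e.2)) C

/-- The free curve `G(d)` of the binary reflected Gray code: `G(0)` is empty, and `G(d + 1)` is
`G(d)`, followed by the positive direction of the last axis, followed by the reverse of `G(d)`. -/
def gray : (d : ℕ) → FreeCurve d
  | 0 => []
  | d + 1 => (gray d).lift ++ [(Fin.last d, 1)] ++ (gray d).rev.lift

/-- The list of the vertices of the free curve `C` when its first vertex is `v`. -/
def FreeCurve.path {d : ℕ} (v : Vertex d) (C : FreeCurve d) : List (Vertex d) :=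
  List.scanl (fun u e => u + Direction.vec e) v C

/-- A signed permutation: it maps the positive direction of axis `j` to the direction with axis
`perm j` and sign `sign j`, and it commutes with negation of directions. -/
structure SignedPerm (d : ℕ) where
  perm : Equiv.Perm (Fin d)
  sign : Fin d → ℤˣ

/-- The direction to which a signed permutation maps a given direction. -/
def SignedPerm.mapDir {d : ℕ} (π : SignedPerm d) (e : Direction d) : Direction d :=
  (π.perm e.1, π.sign e.1 * e.2)

/-- The image of a free curve under a signed permutation. -/
def SignedPerm.map {d : ℕ} (π : SignedPerm d) (C : FreeCurve d) : FreeCurve d :=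
  List.map π.mapDir C

/-- `C` is an isometric image of `G(d)`: up to translation it is the image of `G(d)` under a
signed permutation, or the reverse of such an image. -/
def IsGrayImage {d : ℕ} (C : List (Vertex d)) : Prop :=
  ∃ (v : Vertex d) (π : SignedPerm d),
    C = (π.map (gray d)).path v ∨ C = (π.map (gray d)).rev.path v

/-! ### Inflation, well-folded curves, hyperorthogonal curves -/

/-- `C` can replace the vertex `v` in an inflation: it is a Hamiltonian path on the points
of the unit cube translated by `2 v`. -/
def IsChildCurve {d : ℕ} (v : Vertex d) (C : List (Vertex d)) : Prop :=
  IsCurve C ∧ ∀ w : Vertex d, w ∈ C ↔ ∀ j, w j = 2 * v j ∨ w j = 2 * v j + 1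

/-- The curve `B` is obtained by inflating the curve `A`, where the vertices of `A` are replaced
by the curves in the list `Cs`. That `B` is a curve means that the exit of each child curve forms
an edge with the entry of the next one. This edge has the same direction as the edge of `A` that
it replaces, because it connects the doubled unit cubes of two adjacent vertices of `A`. -/
def IsInflation {d : ℕ} (A : List (Vertex d)) (Cs : List (List (Vertex d)))
    (B : List (Vertex d)) : Prop :=
  List.Forall₂ IsChildCurve A Cs ∧ B = Cs.flatten ∧ IsCurve B

/-- A curve is well-folded if it is a single vertex, or if it is obtained by inflating a
well-folded curve by replacing its vertices by isometric images of `G(d)`. -/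
inductive WellFolded {d : ℕ} : List (Vertex d) → Prop
  | single (v : Vertex d) : WellFolded [v]
  | inflate {A : List (Vertex d)} {Cs : List (List (Vertex d))} {B : List (Vertex d)} :
      WellFolded A → IsInflation A Cs B → (∀ C ∈ Cs, IsGrayImage C) → WellFolded B

/-- The set of the axes of the edges of a curve. -/
def axes {d : ℕ} (C : List (Vertex d)) : Set (Fin d) :=
  {j | ∃ v w : Vertex d, [v, w] <:+: C ∧ v j ≠ w j}

/-- A curve is hyperorthogonal if for all `n ∈ {0, …, d - 2}`, each sequence of `2 ^ n` consecutive
edges (a subcurve with `2 ^ n + 1` vertices) has exactly `n + 1` different axes. -/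
def Hyperorthogonal {d : ℕ} (C : List (Vertex d)) : Prop :=
  ∀ n : ℕ, n + 2 ≤ d → ∀ S : List (Vertex d), S <:+: C → S.length = 2 ^ n + 1 →
    (axes S).ncard = n + 1

/-! ### Space-filling curves -/

/-- `f` restricts to a space-filling curve: a continuous map from `[0, 1]` onto `[0, 1]^d`. -/
def IsSpaceFillingCurve {d : ℕ} (f : ℝ → Fin d → ℝ) : Prop :=
  ContinuousOn f (Icc 0 1) ∧ f '' Icc 0 1 = Icc 0 1

/-- The hypercube of width `1 / 2 ^ k` that is represented by a vertex `v` of the level-`k`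
approximating curve. -/
def cell {d : ℕ} (k : ℕ) (v : Vertex d) : Set (Fin d → ℝ) :=
  Icc (fun j => (v j : ℝ) / 2 ^ k) (fun j => ((v j : ℝ) + 1) / 2 ^ k)

/-- The curves `A 0, A 1, …` approximate `f`: the curve `A 0` is the single vertex at the origin,
each `A (k + 1)` is obtained from `A k` by inflation, and at each level `k` the hypercubes that are
represented by the `2 ^ (d * k)` vertices of `A k` are traversed by `f` one by one in the order of
these vertices, in time intervals of equal length. -/
structure Approximates {d : ℕ} (A : ℕ → List (Vertex d)) (f : ℝ → Fin d → ℝ) : Prop where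
  zero : A 0 = [0]
  succ : ∀ k, ∃ Cs, IsInflation (A k) Cs (A (k + 1))
  traverse : ∀ (k i : ℕ) (hi : i < (A k).length),
    f '' Icc ((i : ℝ) / 2 ^ (d * k)) (((i : ℝ) + 1) / 2 ^ (d * k)) = cell k (A k)[i]

/-- The smallest closed axis-aligned box that contains a set. -/
def boundingBox {d : ℕ} (S : Set (Fin d → ℝ)) : Set (Fin d → ℝ) :=
  ⋂ (l : Fin d → ℝ) (u : Fin d → ℝ) (_ : S ⊆ Icc l u), Icc l u

/-- The box-to-curve ratio: the volume of the bounding box of `S`, divided by the volume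
of `S`. -/
noncomputable def boxToCurveRatio {d : ℕ} (S : Set (Fin d → ℝ)) : ENNReal :=
  volume (boundingBox S) / volume S

end GridCurve

namespace GridCurve

/-! ### The axes of the binary reflected Gray code -/

/-! Take the first level at which `[a, b]` contains a whole interval of the subdivision, and let `V
≥ 1` count these intervals. The section contains `V` cells and is covered by at most `V + 2`
consecutive ones. As the previous level had no whole interval, these cells lie in two consecutive
blocks of `2 ^ d`. It remains to enclose such a run of vertices in a box of at most `4 * V` grid
points (`WellFolded.fitsInBox`).

If all widths are at most 2, the box has `2 ^ t` points, where `t` is the number of axes used. If `2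
^ n` is the least power of two that is at least `V + 1`, hyperorthogonality gives `t ≤ n + 1`, and
`2 ^ (n - 1) ≤ V` (`Hyperorthogonal.two_pow_ncard_moved_le`).

A larger width occurs only along the axis `j₀` of the edge between the blocks, when the run also
moves along `j₀` inside a block. In the Gray order, hyperorthogonality then forces at least `2 ^ (d
- 2)` steps on that side (`two_pow_le_of_mem_moved`). So for `V < 2 ^ (d - 1)` this happens on one
side only and the width is 3. A short other side adds no axis (`moved₂_ncard_le`), and a long one
makes `V` large enough. For `V ≥ 2 ^ (d - 1)`, the full double block suffices. -/

theorem length_gray (d : ℕ) : (gray d).length + 1 = 2 ^ d := by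
  induction d with
  | zero => simp [gray]
  | succ d ih =>
    simp only [gray, FreeCurve.lift, FreeCurve.rev, List.length_append, List.length_map,
      List.length_reverse, List.length_cons, List.length_nil, pow_succ]
    omega

/-- The sequence of the axes of the edges of `G(d)`. -/
def grayAxes (d : ℕ) : List (Fin d) := (gray d).map Prod.fst

theorem length_grayAxes (d : ℕ) : (grayAxes d).length + 1 = 2 ^ d := by
  simp [grayAxes, length_gray]

theorem grayAxes_succ (d : ℕ) :
    grayAxes (d + 1) = (grayAxes d).map Fin.castSucc ++ [Fin.last d] ++
      (grayAxes d).reverse.map Fin.castSucc := by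
  simp [grayAxes, gray, FreeCurve.lift, FreeCurve.rev, Function.comp_def]

/-- This symmetry lets a block be read from either end, so both sides of a connecting edge start
like a Gray code. -/
theorem reverse_grayAxes (d : ℕ) : (grayAxes d).reverse = grayAxes d := by
  induction d with
  | zero => simp [grayAxes, gray]
  | succ d ih => simp [grayAxes_succ, ih, ← List.map_reverse]

theorem grayAxes_two_pow (d : ℕ) (i : Fin d) : (grayAxes d)[2 ^ (i : ℕ) - 1]? = some i := by
  induction d with
  | zero => exact i.elim0
  | succ d ih =>
    have hl := length_grayAxes d
    rw [grayAxes_succ]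
    induction i using Fin.lastCases with
    | last =>
      rw [List.getElem?_append_left (by simp; omega), List.getElem?_append_right (by simp; omega)]
      have : 2 ^ d - 1 - (grayAxes d).length = 0 := by omega
      simp [this]
    | cast i =>
      have h1 : 2 ^ (i : ℕ) < 2 ^ d := Nat.pow_lt_pow_right (by norm_num) i.2
      have h2 : 0 < 2 ^ (i : ℕ) := by positivity
      rw [List.getElem?_append_left (by simp; omega),
        List.getElem?_append_left (by simp; omega)]
      simp [ih i]

theorem grayAxes_lt (d m r : ℕ) (hr : r + 1 < 2 ^ m) (j : Fin d)
    (hj : (grayAxes d)[r]? = some j) : (j : ℕ) < m := by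
  induction d with
  | zero => exact j.elim0
  | succ d ih =>
    rcases Nat.lt_or_ge d m with h | h
    · omega
    have hl := length_grayAxes d
    have h1 : 2 ^ m ≤ 2 ^ d := Nat.pow_le_pow_right (by norm_num) h
    rw [grayAxes_succ, List.getElem?_append_left (by simp; omega),
        List.getElem?_append_left (by simp; omega), List.getElem?_map] at hj
    obtain ⟨i, hi, rfl⟩ := Option.map_eq_some_iff.1 hj
    simpa using ih i hi

/-! ### Sequences of vertices that move like the Gray code -/

/-- The axes along which the first `q` steps of a sequence of vertices move. -/
def moved {d : ℕ} (β : ℕ → Vertex d) (q : ℕ) : Set (Fin d) :=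
  {j | ∃ r < q, β r j ≠ β (r + 1) j}

theorem moved_mono {d : ℕ} (β : ℕ → Vertex d) {p q : ℕ} (h : p ≤ q) : moved β p ⊆ moved β q :=
  fun _ ⟨r, hr, hj⟩ => ⟨r, hr.trans_le h, hj⟩

theorem eq_of_notMem_moved {d : ℕ} {β : ℕ → Vertex d} {q : ℕ} {j : Fin d}
    (h : j ∉ moved β q) {r : ℕ} (hr : r ≤ q) : β r j = β 0 j := by
  induction r with
  | zero => rfl
  | succ r ih =>
    rw [← ih (by omega)]
    by_contra hne
    exact h ⟨r, by omega, Ne.symm hne⟩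

/-- Up to a permutation of the axes, the first `2 ^ d - 1` steps of `β` use the same axes as
the Gray code `G(d)`: those before step `2 ^ m` use the first `m` axes, and step `2 ^ i` uses
axis `i`. -/
def IsGraySequence {d : ℕ} (β : ℕ → Vertex d) (π : Equiv.Perm (Fin d)) : Prop :=
  (∀ m q, q < 2 ^ m → q < 2 ^ d → moved β q ⊆ {j | (π.symm j : ℕ) < m}) ∧
    ∀ (i : Fin d) (q : ℕ), 2 ^ (i : ℕ) ≤ q → π i ∈ moved β q

theorem isGraySequence_of_grayAxes {d : ℕ} {β : ℕ → Vertex d} {π : Equiv.Perm (Fin d)}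
    (h : ∀ r i, (grayAxes d)[r]? = some i → ∀ j, β r j ≠ β (r + 1) j ↔ j = π i) :
    IsGraySequence β π := by
  refine ⟨fun m q hm hd j ⟨r, hr, hj⟩ => ?_, fun i q hq => ?_⟩
  · have hl := length_grayAxes d
    have hr' : r < (grayAxes d).length := by omega
    have hs := List.getElem?_eq_getElem hr'
    have := (h r _ hs j).1 hj
    simp only [mem_ofPred_eq, this, Equiv.symm_apply_apply]
    exact grayAxes_lt d m r (by omega) _ hs
  · have h2 : 0 < 2 ^ (i : ℕ) := by positivity
    refine ⟨2 ^ (i : ℕ) - 1, by omega, ?_⟩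
    exact (h _ _ (grayAxes_two_pow d i) _).2 rfl

theorem ne_add_vec_iff {d : ℕ} (v : Vertex d) (e : Direction d) (j : Fin d) :
    v j ≠ (v + e.vec) j ↔ j = e.1 := by
  rcases eq_or_ne j e.1 with rfl | h
  · simp [Direction.vec]
  · simp [Direction.vec, h]

theorem path_ne_iff {d : ℕ} (v : Vertex d) (E : FreeCurve d) {r : ℕ} {i : Fin d}
    (hr : (E.map Prod.fst)[r]? = some i) (j : Fin d) :
    (E.path v).getD r 0 j ≠ (E.path v).getD (r + 1) 0 j ↔ j = i := by
  rw [List.getElem?_map] at hr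
  obtain ⟨e, he, rfl⟩ := Option.map_eq_some_iff.1 hr
  obtain ⟨hr', rfl⟩ := List.getElem?_eq_some_iff.1 he
  have hl : (E.path v).length = E.length + 1 := List.length_scanl
  rw [List.getD_eq_getElem _ _ (by omega), List.getD_eq_getElem _ _ (by omega)]
  have : (E.path v)[r + 1]'(by omega) = (E.path v)[r]'(by omega) + (E[r]).vec :=
    List.getElem_succ_scanl _
  rw [this]
  exact ne_add_vec_iff _ _ _

theorem IsGrayImage.exists_perm {d : ℕ} {C : List (Vertex d)} (hC : IsGrayImage C) :
    C.length = 2 ^ d ∧ ∃ π : Equiv.Perm (Fin d), ∀ r i, (grayAxes d)[r]? = some i →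
      ∀ j, C.getD r 0 j ≠ C.getD (r + 1) 0 j ↔ j = π i := by
  have key : ∃ (v : Vertex d) (E : FreeCurve d) (π : Equiv.Perm (Fin d)),
      E.map Prod.fst = (grayAxes d).map π ∧ C = E.path v := by
    obtain ⟨v, π, h | h⟩ := hC
    · exact ⟨v, _, π.perm, by simp [SignedPerm.map, grayAxes, SignedPerm.mapDir], h⟩
    · refine ⟨v, _, π.perm, ?_, h⟩
      rw [← reverse_grayAxes]
      simp [SignedPerm.map, grayAxes, SignedPerm.mapDir, FreeCurve.rev]
  obtain ⟨v, E, π, hE, rfl⟩ := key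
  refine ⟨?_, π, fun r i hi j => path_ne_iff v E ?_ j⟩
  · have hl : (E.path v).length = E.length + 1 := List.length_scanl
    have := congrArg List.length hE
    have := length_grayAxes d
    simp only [List.length_map] at *
    omega
  · rw [hE, List.getElem?_map, hi]; rfl

theorem IsGrayImage.isGraySequence {d : ℕ} {C : List (Vertex d)} (hC : IsGrayImage C) :
    ∃ π, IsGraySequence (fun r => C.getD r 0) π := by
  obtain ⟨-, π, h⟩ := hC.exists_perm
  exact ⟨π, isGraySequence_of_grayAxes h⟩

theorem IsGrayImage.isGraySequence_reverse {d : ℕ} {C : List (Vertex d)} (hC : IsGrayImage C) :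
    ∃ π, IsGraySequence (fun r => C.getD (2 ^ d - 1 - r) 0) π := by
  obtain ⟨-, π, h⟩ := hC.exists_perm
  refine ⟨π, isGraySequence_of_grayAxes fun r i hi j => ?_⟩
  have hl := length_grayAxes d
  obtain ⟨hr, -⟩ := List.getElem?_eq_some_iff.1 hi
  rw [← reverse_grayAxes, List.getElem?_reverse hr] at hi
  rw [← h _ _ hi j, ne_comm]
  have h1 : 2 ^ d - 1 - r = (grayAxes d).length - 1 - r + 1 := by omega
  have h2 : 2 ^ d - 1 - (r + 1) = (grayAxes d).length - 1 - r := by omega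
  simp only [h1, h2]

/-! ### The blocks of a well-folded curve -/

theorem IsChildCurve.length_eq {d : ℕ} {v : Vertex d} {C : List (Vertex d)}
    (h : IsChildCurve v C) : C.length = 2 ^ d := by
  have h1 : C.toFinset = Fintype.piFinset fun j => ({2 * v j, 2 * v j + 1} : Finset ℤ) := by
    ext w
    simp [h.2 w]
  rw [← List.toFinset_card_of_nodup h.1.1, h1, Fintype.card_piFinset]
  simp

theorem getElem?_flatten_of_length_eq {α : Type*} {D : ℕ} {Cs : List (List α)}
    (h : ∀ C ∈ Cs, C.length = D) {m r : ℕ} (hr : r < D) (hm : m < Cs.length) :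
    Cs.flatten[D * m + r]? = Cs[m][r]? := by
  induction Cs generalizing m with
  | nil => simp at hm
  | cons C Cs ih =>
    have hC := h C (by simp)
    cases m with
    | zero => simp [List.getElem?_append_left (show r < C.length by omega)]
    | succ m =>
      rw [List.flatten_cons, List.getElem?_append_right (by rw [hC]; nlinarith)]
      have : D * (m + 1) + r - C.length = D * m + r := by rw [hC, Nat.mul_succ]; omega
      rw [this, ih (fun C hC => h C (by simp [hC])) (by simpa using hm)]
      simp

theorem length_flatten_of_length_eq {α : Type*} {D : ℕ} {Cs : List (List α)}
    (h : ∀ C ∈ Cs, C.length = D) : Cs.flatten.length = D * Cs.length := by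
  rw [List.length_flatten, List.eq_replicate_of_mem (a := D) (l := Cs.map List.length) (by simpa)]
  simp [mul_comm]

theorem IsInflation.length_eq_of_mem {d : ℕ} {A B : List (Vertex d)} {Cs : List (List (Vertex d))}
    (h : IsInflation A Cs B) {C : List (Vertex d)} (hC : C ∈ Cs) : C.length = 2 ^ d := by
  obtain ⟨i, hi, rfl⟩ := List.getElem_of_mem hC
  have h1 := h.1.length_eq
  exact (h.1.get (by omega) hi).length_eq

theorem IsInflation.length_eq {d : ℕ} {A B : List (Vertex d)} {Cs : List (List (Vertex d))}
    (h : IsInflation A Cs B) : B.length = 2 ^ d * A.length := by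
  rw [h.2.1, length_flatten_of_length_eq fun C => h.length_eq_of_mem, h.1.length_eq]

theorem WellFolded.isCurve {d : ℕ} {B : List (Vertex d)} (h : WellFolded B) : IsCurve B := by
  cases h with
  | single v => simp [IsCurve]
  | inflate _ h _ => exact h.2.2

/-- The part of the sequence `v` with indices in `[D * m, D * (m + 1))`, for `D = 2 ^ d`, lies in
the cube `2 w + {0, 1}^d` and is traversed, in both orders, like the Gray code. -/
structure IsGrayBlock {d : ℕ} (v : ℕ → Vertex d) (m : ℕ) (w : Vertex d) : Prop where
  mem : ∀ r < 2 ^ d, ∀ j, v (2 ^ d * m + r) j = 2 * w j ∨ v (2 ^ d * m + r) j = 2 * w j + 1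
  forward : ∃ π, IsGraySequence (fun r => v (2 ^ d * m + r)) π
  backward : ∃ π, IsGraySequence (fun r => v (2 ^ d * m + (2 ^ d - 1 - r))) π

/-- Values outside the block, including list defaults, are harmless: the upper bound stops at `q < 2
^ d`, and the lower bound is decided at `q = 2 ^ i ≤ 2 ^ (d - 1)`. -/
theorem IsGraySequence.congr {d : ℕ} {β γ : ℕ → Vertex d} {π : Equiv.Perm (Fin d)}
    (h : IsGraySequence β π) (hβ : ∀ r < 2 ^ d, β r = γ r) : IsGraySequence γ π := by
  have hm : ∀ q < 2 ^ d, moved γ q = moved β q := fun q hq => by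
    ext j
    refine exists_congr fun r => and_congr_right fun hr => ?_
    rw [hβ r (by omega), hβ (r + 1) (by omega)]
  refine ⟨fun m q h1 h2 => hm q h2 ▸ h.1 m q h1 h2, fun i q hq => ?_⟩
  have h1 : 2 ^ (i : ℕ) < 2 ^ d := Nat.pow_lt_pow_right (by norm_num) i.2
  exact moved_mono γ hq (hm _ h1 ▸ h.2 i _ le_rfl)

theorem WellFolded.exists_blocks {d : ℕ} {B : List (Vertex d)} (h : WellFolded B)
    (hB : B.length ≠ 1) : ∃ (M : ℕ) (w : ℕ → Vertex d), B.length = 2 ^ d * M ∧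
      (∀ m < M, IsGrayBlock (fun i => B.getD i 0) m (w m)) ∧
      ∀ m, m + 1 < M → IsEdge (w m) (w (m + 1)) := by
  cases h with
  | single v => simp at hB
  | @inflate A Cs _ hA hI hG =>
    have hlen := hI.1.length_eq
    have hget : ∀ m (hm : m < Cs.length), ∀ r < 2 ^ d,
        B.getD (2 ^ d * m + r) 0 = Cs[m].getD r 0 := fun m hm r hr => by
      rw [List.getD_eq_getElem?_getD, List.getD_eq_getElem?_getD, hI.2.1,
        getElem?_flatten_of_length_eq (fun C => hI.length_eq_of_mem) hr hm]
    refine ⟨A.length, fun i => A.getD i 0, hI.length_eq, fun m hm => ?_, fun m hm => ?_⟩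
    · have hm' : m < Cs.length := by omega
      have hg := hG Cs[m] (List.getElem_mem hm')
      refine ⟨fun r hr j => ?_, ?_, ?_⟩
      · have hc : IsChildCurve A[m] Cs[m] := hI.1.get hm hm'
        simp only [List.getD_eq_getElem A _ hm]
        refine (hc.2 _).1 ?_ j
        simp only [hget m hm' r hr]
        rw [List.getD_eq_getElem _ _ (by rw [hc.length_eq]; exact hr)]
        exact List.getElem_mem _
      · obtain ⟨π, hπ⟩ := hg.isGraySequence
        exact ⟨π, hπ.congr fun r hr => (hget m hm' r hr).symm⟩
      · obtain ⟨π, hπ⟩ := hg.isGraySequence_reverse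
        exact ⟨π, hπ.congr fun r hr => (hget m hm' _ (by omega)).symm⟩
    · have := List.isChain_iff_getElem.1 hA.isCurve.2 m hm
      simpa only [List.getD_eq_getElem A _ hm, List.getD_eq_getElem A _ (show m < A.length by omega)]
        using this

/-! ### Widths of sections of a curve -/

/-- The `j`-th coordinates of the vertices in `s` lie among `n` consecutive integers. -/
def HasWidth {d : ℕ} (s : Set (Vertex d)) (j : Fin d) (n : ℕ) : Prop :=
  ∃ l : ℤ, ∀ v ∈ s, l ≤ v j ∧ v j < l + n

open Classical in
theorem prod_ite_two_eq {d : ℕ} (T : Set (Fin d)) :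
    ∏ j, (if j ∈ T then 2 else 1) = 2 ^ T.ncard := by
  rw [Finset.prod_ite, Finset.prod_const, Finset.prod_const, one_pow, mul_one,
    ← Set.ncard_coe_finset]
  congr 2
  ext; simp

open Classical in
theorem prod_ite_eq_two_le {d : ℕ} {T : Set (Fin d)} {j₀ : Fin d} (h₀ : j₀ ∈ T) {t : ℕ}
    (hT : T.ncard ≤ t + 1) (w : ℕ) :
    ∏ j, (if j = j₀ then w else if j ∈ T then 2 else 1) ≤ w * 2 ^ t := by
  have h1 := prod_ite_two_eq T
  rw [← Finset.mul_prod_erase _ _ (Finset.mem_univ j₀)] at h1 ⊢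
  rw [if_pos h₀] at h1
  rw [if_pos rfl, Finset.prod_congr rfl (g := fun j => if j ∈ T then 2 else 1)
    fun j hj => if_neg (Finset.ne_of_mem_erase hj)]
  have h2 : 2 ^ T.ncard ≤ 2 ^ (t + 1) := Nat.pow_le_pow_right (by norm_num) hT
  rw [pow_succ] at h2
  exact Nat.mul_le_mul_left _ (by omega)

theorem ncard_le_dim {d : ℕ} (T : Set (Fin d)) : T.ncard ≤ d := by
  simpa using Set.ncard_le_card T

theorem ncard_symm_lt {d m : ℕ} (π : Equiv.Perm (Fin d)) (hm : m ≤ d) :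
    {j : Fin d | (π.symm j : ℕ) < m}.ncard = m := by
  have : {j : Fin d | (π.symm j : ℕ) < m} = π '' Set.range (Fin.castLE hm) := by
    ext j
    simp only [mem_ofPred_eq, mem_image, mem_range, exists_exists_eq_and]
    constructor
    · intro h
      exact ⟨⟨_, h⟩, by simp⟩
    · rintro ⟨a, rfl⟩
      simp
  rw [this, Set.ncard_image_of_injective _ π.injective, ← Set.image_univ,
    Set.ncard_image_of_injective _ (Fin.castLE_injective hm)]
  simp

/-- Two sequences of vertices that start at the two ends of an edge with axis `j₀`, and that remain
in the adjacent cubes `2 wα + {0, 1}^d` and `2 wβ + {0, 1}^d`. -/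
structure AdjacentBlocks {d : ℕ} (α β : ℕ → Vertex d) (wα wβ : Vertex d) (j₀ : Fin d) : Prop where
  memα : ∀ r < 2 ^ d, ∀ j, α r j = 2 * wα j ∨ α r j = 2 * wα j + 1
  memβ : ∀ r < 2 ^ d, ∀ j, β r j = 2 * wβ j ∨ β r j = 2 * wβ j + 1
  w_eq : ∀ j, j ≠ j₀ → wα j = wβ j
  w_adj : wα j₀ = wβ j₀ + 1 ∨ wβ j₀ = wα j₀ + 1
  start_eq : ∀ j, j ≠ j₀ → α 0 j = β 0 j
  start_adj : α 0 j₀ = β 0 j₀ + 1 ∨ β 0 j₀ = α 0 j₀ + 1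

/-- The vertices up to index `p` of the sequence `α` and up to index `q` of `β`. -/
def section₂ {d : ℕ} (α β : ℕ → Vertex d) (p q : ℕ) : Set (Vertex d) :=
  {v | (∃ r ≤ p, v = α r) ∨ ∃ r ≤ q, v = β r}

theorem section₂_comm {d : ℕ} (α β : ℕ → Vertex d) (p q : ℕ) :
    section₂ α β p q = section₂ β α q p := by
  ext v
  exact or_comm

/-- The axes of the first `p` steps of `α`, the first `q` steps of `β`, and the connecting edge. -/
def moved₂ {d : ℕ} (α β : ℕ → Vertex d) (j₀ : Fin d) (p q : ℕ) : Set (Fin d) :=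
  insert j₀ (moved α p ∪ moved β q)

theorem moved₂_comm {d : ℕ} (α β : ℕ → Vertex d) (j₀ : Fin d) (p q : ℕ) :
    moved₂ α β j₀ p q = moved₂ β α j₀ q p := by
  rw [moved₂, moved₂, Set.union_comm]

/-! ### Widths of a section that crosses a connecting edge -/

namespace AdjacentBlocks

variable {d : ℕ} {α β : ℕ → Vertex d} {wα wβ : Vertex d} {j₀ : Fin d} {p q : ℕ}

theorem symm (h : AdjacentBlocks α β wα wβ j₀) : AdjacentBlocks β α wβ wα j₀ :=
  ⟨h.memβ, h.memα, fun j hj => (h.w_eq j hj).symm, h.w_adj.symm,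
    fun j hj => (h.start_eq j hj).symm, h.start_adj.symm⟩

theorem hasWidth_two (h : AdjacentBlocks α β wα wβ j₀) (hp : p < 2 ^ d) (hq : q < 2 ^ d)
    {j : Fin d} (hj : j ≠ j₀) : HasWidth (section₂ α β p q) j 2 := by
  refine ⟨2 * wα j, ?_⟩
  have := h.w_eq j hj
  rintro v (⟨r, hr, rfl⟩ | ⟨r, hr, rfl⟩)
  · have := h.memα r (by omega) j
    omega
  · have := h.memβ r (by omega) j
    omega

theorem hasWidth_one (h : AdjacentBlocks α β wα wβ j₀) {j : Fin d}
    (hj : j ∉ moved₂ α β j₀ p q) : HasWidth (section₂ α β p q) j 1 := by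
  simp only [moved₂, mem_insert_iff, mem_union, not_or] at hj
  refine ⟨α 0 j, ?_⟩
  have h0 := h.start_eq j hj.1
  rintro v (⟨r, hr, rfl⟩ | ⟨r, hr, rfl⟩)
  · have := eq_of_notMem_moved hj.2.1 hr
    omega
  · have := eq_of_notMem_moved hj.2.2 hr
    omega

theorem hasWidth_two_of_notMem (h : AdjacentBlocks α β wα wβ j₀)
    (hα : j₀ ∉ moved α p) (hβ : j₀ ∉ moved β q) : HasWidth (section₂ α β p q) j₀ 2 := by
  refine ⟨min (α 0 j₀) (β 0 j₀), ?_⟩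
  have := h.start_adj
  rintro v (⟨r, hr, rfl⟩ | ⟨r, hr, rfl⟩)
  · have := eq_of_notMem_moved hα hr
    omega
  · have := eq_of_notMem_moved hβ hr
    omega

/-- The side `α` stays in the layer where it starts, which touches the cube of `β`: one layer next
to two. -/
theorem hasWidth_three_of_notMem (h : AdjacentBlocks α β wα wβ j₀) (hq : q < 2 ^ d)
    (hα : j₀ ∉ moved α p) : HasWidth (section₂ α β p q) j₀ 3 := by
  refine ⟨min (α 0 j₀) (2 * wβ j₀), ?_⟩
  have := h.start_adj
  have := h.w_adj
  have hα0 := h.memα 0 (by positivity) j₀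
  have hβ0 := h.memβ 0 (by positivity) j₀
  rintro v (⟨r, hr, rfl⟩ | ⟨r, hr, rfl⟩)
  · have := eq_of_notMem_moved hα hr
    omega
  · have := h.memβ r (by omega) j₀
    omega

theorem hasWidth_four (h : AdjacentBlocks α β wα wβ j₀) (hp : p < 2 ^ d) (hq : q < 2 ^ d) :
    HasWidth (section₂ α β p q) j₀ 4 := by
  refine ⟨min (2 * wα j₀) (2 * wβ j₀), ?_⟩
  have := h.w_adj
  rintro v (⟨r, hr, rfl⟩ | ⟨r, hr, rfl⟩)
  · have := h.memα r (by omega) j₀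
    omega
  · have := h.memβ r (by omega) j₀
    omega

open Classical in
theorem hasWidth_ite (h : AdjacentBlocks α β wα wβ j₀) (hp : p < 2 ^ d) (hq : q < 2 ^ d) {w : ℕ}
    (hw : HasWidth (section₂ α β p q) j₀ w) {T : Set (Fin d)} (hT : moved₂ α β j₀ p q ⊆ T)
    (j : Fin d) :
    HasWidth (section₂ α β p q) j (if j = j₀ then w else if j ∈ T then 2 else 1) := by
  split_ifs with h1 h2
  · exact h1 ▸ hw
  · exact h.hasWidth_two hp hq h1
  · exact h.hasWidth_one fun hj => h2 (hT hj)

end AdjacentBlocks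

/-- The connecting edge and the next `2 ^ c - 1` steps of `β` must use `c + 1` axes, but those steps
supply only the first `c` Gray axes. Hence `j₀` is not among them. -/
theorem two_pow_le_of_mem_moved {d c : ℕ} (hd : d = c + 2) {α β : ℕ → Vertex d} {j₀ : Fin d}
    {π : Equiv.Perm (Fin d)} (hβ : IsGraySequence β π)
    (hH : ∀ p q, p + q + 1 = 2 ^ c → (moved₂ α β j₀ p q).ncard = c + 1)
    {q : ℕ} (hq : j₀ ∈ moved β q) : 2 ^ c ≤ q := by
  by_contra! hlt
  have hcd : 2 ^ c < 2 ^ d := Nat.pow_lt_pow_right (by norm_num) (by omega)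
  have h1 := hH 0 (2 ^ c - 1) (by omega)
  have h2 : moved₂ α β j₀ 0 (2 ^ c - 1) ⊆ {j | (π.symm j : ℕ) < c} := by
    have hs := hβ.1 c (2 ^ c - 1) (by omega) (by omega)
    rintro j (rfl | ⟨r, hr, -⟩ | hj)
    · exact hs (moved_mono β (by omega) hq)
    · omega
    · exact hs hj
  have h3 := Set.ncard_le_ncard h2
  rw [ncard_symm_lt π (by omega)] at h3
  omega

/-- Consider the window of `2 ^ c` edges that contains the `p` steps of `α`. Its part in `β` has at
least `2 ^ (c - 1)` steps when `c ≥ 1`, hence uses the first `c` Gray axes, and `j₀` must be the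
next one. These fill the quota of `c + 1` axes, so `α` brings no other axis. -/
theorem moved₂_ncard_le {d c : ℕ} (hd : d = c + 2) {α β : ℕ → Vertex d} {j₀ : Fin d}
    {π : Equiv.Perm (Fin d)} (hβ : IsGraySequence β π)
    (hH : ∀ p q, p + q + 1 = 2 ^ c → (moved₂ α β j₀ p q).ncard = c + 1)
    {p q : ℕ} (hj₀ : j₀ ∈ moved β q) (hq : q < 2 ^ (c + 1)) (hp : 2 * p < 2 ^ c) :
    (moved₂ α β j₀ p q).ncard ≤ c + 1 := by
  have hcd : 2 ^ (c + 1) < 2 ^ d := Nat.pow_lt_pow_right (by norm_num) (by omega)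
  have hs := hβ.1 (c + 1) q hq (by omega)
  have hj₀' : (π.symm j₀ : ℕ) < c + 1 := hs hj₀
  have hmem : ∀ j, (π.symm j : ℕ) < c → j ∈ moved β (2 ^ c - 1 - p) := fun j hj => by
    have h2 : 2 ^ (π.symm j : ℕ) ≤ 2 ^ (c - 1) := Nat.pow_le_pow_right (by norm_num) (by omega)
    have h3 : 2 ^ c = 2 * 2 ^ (c - 1) := by rw [← pow_succ']; congr 1; omega
    simpa using hβ.2 (π.symm j) (2 ^ c - 1 - p) (by omega)
  have hj₀'' : (π.symm j₀ : ℕ) = c := by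
    by_contra hne
    have := two_pow_le_of_mem_moved hd hβ hH (hmem j₀ (by omega))
    have : 0 < 2 ^ c := by positivity
    omega
  have hsub : {j | (π.symm j : ℕ) < c + 1} ⊆ moved₂ α β j₀ p (2 ^ c - 1 - p) := fun j hj => by
    rcases Nat.lt_succ_iff_lt_or_eq.1 hj with h | h
    · exact Or.inr (Or.inr (hmem j h))
    · refine Or.inl (π.symm.injective (Fin.ext ?_))
      omega
  have heq := Set.eq_of_subset_of_ncard_le hsub (by
    rw [hH p _ (by omega), ncard_symm_lt π (by omega)])
  have hfin : moved₂ α β j₀ p q ⊆ {j | (π.symm j : ℕ) < c + 1} := by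
    rintro j (rfl | hj | hj)
    · exact hj₀'
    · rw [heq]
      exact Or.inr (Or.inl hj)
    · exact hs hj
  have := Set.ncard_le_ncard hfin
  rwa [ncard_symm_lt π (by omega)] at this

/-- The vertices in `s` lie in a box that contains at most `4 * V` vertices. -/
def FitsInBox {d : ℕ} (s : Set (Vertex d)) (V : ℕ) : Prop :=
  ∃ n : Fin d → ℕ, (∀ j, HasWidth s j (n j)) ∧ ∏ j, n j ≤ 4 * V

theorem AdjacentBlocks.fitsInBox_of_mem_moved {d c : ℕ} (hd : d = c + 2) {α β : ℕ → Vertex d}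
    {wα wβ : Vertex d} {j₀ : Fin d} (h : AdjacentBlocks α β wα wβ j₀) {πα πβ : Equiv.Perm (Fin d)}
    (hα : IsGraySequence α πα) (hβ : IsGraySequence β πβ)
    (hH : ∀ p q, p + q + 1 = 2 ^ c → (moved₂ α β j₀ p q).ncard = c + 1)
    {p q V : ℕ} (hp : p < 2 ^ d) (hq : q < 2 ^ d) (hpq : p + q ≤ V) (hV : V < 2 ^ (c + 1))
    (hj₀ : j₀ ∈ moved β q) : FitsInBox (section₂ α β p q) V := by
  classical
  have hq' := two_pow_le_of_mem_moved hd hβ hH hj₀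
  have hp' : j₀ ∉ moved α p := fun hmem => by
    have := two_pow_le_of_mem_moved hd (α := β) hα
      (fun p q hpq => moved₂_comm α β j₀ q p ▸ hH q p (by omega)) hmem
    rw [pow_succ] at hV
    omega
  refine ⟨_, h.hasWidth_ite hp hq (h.hasWidth_three_of_notMem hq hp') Subset.rfl, ?_⟩
  -- With `q ≥ 2 ^ c`: a short `α` side gives a box of at most `3 * 2 ^ c ≤ 4 * q` points. Otherwise
  -- all `c + 2` axes are allowed, and `3 * 2 ^ (c + 1) ≤ 4 * (p + q)`.
  rcases Nat.lt_or_ge (2 * p) (2 ^ c) with h2 | h2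
  · have := prod_ite_eq_two_le (mem_insert _ _) (moved₂_ncard_le hd hβ hH hj₀ (by omega) h2) 3
    exact this.trans (by omega)
  · have := prod_ite_eq_two_le (T := moved₂ α β j₀ p q) (mem_insert _ _)
      (t := c + 1) ((ncard_le_dim _).trans (by omega)) 3
    refine this.trans ?_
    rw [pow_succ]
    omega

theorem AdjacentBlocks.fitsInBox {d : ℕ} (hd : 1 ≤ d) {α β : ℕ → Vertex d}
    {wα wβ : Vertex d} {j₀ : Fin d} (h : AdjacentBlocks α β wα wβ j₀) {πα πβ : Equiv.Perm (Fin d)}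
    (hα : IsGraySequence α πα) (hβ : IsGraySequence β πβ)
    (hH : ∀ c, d = c + 2 → ∀ p q, p + q + 1 = 2 ^ c → (moved₂ α β j₀ p q).ncard = c + 1)
    {p q V : ℕ} (hp : p < 2 ^ d) (hq : q < 2 ^ d) (hpq : p + q ≤ V) (hV : 1 ≤ V)
    (hT : 2 ^ (moved₂ α β j₀ p q).ncard ≤ 4 * V) : FitsInBox (section₂ α β p q) V := by
  classical
  by_cases h1 : j₀ ∈ moved α p ∨ j₀ ∈ moved β q
  · rcases Nat.lt_or_ge V (2 ^ (d - 1)) with h2 | h2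
    · obtain ⟨c, rfl⟩ : ∃ c, d = c + 2 := by
        refine ⟨d - 2, ?_⟩
        by_contra hne
        have : d = 1 := by omega
        subst this
        simp at h2
        omega
      rcases h1 with h1 | h1
      · rw [section₂_comm]
        exact h.symm.fitsInBox_of_mem_moved rfl hβ hα
          (fun p q hpq => moved₂_comm α β j₀ q p ▸ hH c rfl q p (by omega)) hq hp (by omega) h2 h1
      · exact h.fitsInBox_of_mem_moved rfl hα hβ (hH c rfl) hp hq hpq h2 h1
    -- The two blocks together form a box of `4 * 2 ^ (d - 1)` points.
    · refine ⟨_, h.hasWidth_ite hp hq (h.hasWidth_four hp hq) Subset.rfl, ?_⟩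
      have := prod_ite_eq_two_le (T := moved₂ α β j₀ p q) (mem_insert _ _)
        (t := d - 1) ((ncard_le_dim _).trans (by omega)) 4
      exact this.trans (by omega)
  · rw [not_or] at h1
    refine ⟨fun j => if j ∈ moved₂ α β j₀ p q then 2 else 1, fun j => ?_, ?_⟩
    · have := h.hasWidth_ite hp hq (h.hasWidth_two_of_notMem h1.1 h1.2) Subset.rfl j
      by_cases hj : j = j₀
      · subst hj
        simpa [moved₂] using this
      · simpa [hj] using this
    · rwa [prod_ite_two_eq]

/-! ### Sections of a hyperorthogonal well-folded curve -/

theorem mem_axes_take_drop_iff {d : ℕ} {L : List (Vertex d)} {s m : ℕ} (h : s + m < L.length)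
    (j : Fin d) :
    j ∈ axes ((L.drop s).take (m + 1)) ↔ j ∈ moved (fun r => L.getD (s + r) 0) m := by
  have hlen : ((L.drop s).take (m + 1)).length = m + 1 := by simp; omega
  have hget : ∀ r, r < m + 1 → ((L.drop s).take (m + 1))[r]? = some (L.getD (s + r) 0) :=
    fun r hr => by
      rw [List.getElem?_take_of_lt hr, List.getElem?_drop, List.getD_eq_getElem _ _ (by omega),
        List.getElem?_eq_getElem]
  constructor
  · rintro ⟨v, w, hvw, hne⟩
    obtain ⟨r, hr, hi⟩ := List.infix_iff_getElem?.1 hvw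
    simp only [List.length_cons, List.length_nil, hlen] at hr hi
    have h0 := hi 0 (by omega)
    have h1 := hi 1 (by omega)
    rw [hget _ (by omega)] at h0 h1
    simp only [List.getElem_cons_zero, List.getElem_cons_succ, Option.some.injEq] at h0 h1
    refine ⟨r, by omega, ?_⟩
    subst h0 h1
    simpa [Nat.add_comm] using hne
  · rintro ⟨r, hr, hne⟩
    refine ⟨_, _, List.infix_iff_getElem?.2
      ⟨r, by simp only [List.length_cons, List.length_nil, hlen]; omega, fun i hi => ?_⟩, hne⟩
    simp only [List.length_cons, List.length_nil] at hi
    obtain rfl | rfl : i = 0 ∨ i = 1 := by omega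
    · rw [hget _ (by omega)]; simp
    · rw [hget _ (by omega)]; simp [Nat.add_comm]

theorem Hyperorthogonal.ncard_moved {d : ℕ} {L : List (Vertex d)} (hL : Hyperorthogonal L)
    {n s : ℕ} (hn : n + 2 ≤ d) (hs : s + 2 ^ n < L.length) :
    (moved (fun r => L.getD (s + r) 0) (2 ^ n)).ncard = n + 1 := by
  rw [← hL n hn ((L.drop s).take (2 ^ n + 1))
    ((List.take_prefix _ _).isInfix.trans (List.drop_suffix _ _).isInfix) (by simp; omega)]
  congr 1
  ext j
  exact (mem_axes_take_drop_iff hs j).symm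

theorem moved_shift_subset {d : ℕ} {v : ℕ → Vertex d} {s s' m m' : ℕ} (h : s' ≤ s)
    (h' : s + m ≤ s' + m') : moved (fun r => v (s + r)) m ⊆ moved (fun r => v (s' + r)) m' := by
  rintro j ⟨r, hr, hne⟩
  refine ⟨s + r - s', by omega, ?_⟩
  have h1 : s' + (s + r - s') = s + r := by omega
  have h2 : s' + (s + r - s' + 1) = s + (r + 1) := by omega
  simpa only [h1, h2] using hne

theorem Hyperorthogonal.two_pow_ncard_moved_le {d : ℕ} {L : List (Vertex d)}
    (hL : Hyperorthogonal L) (hlen : 2 ^ d ≤ L.length) {s m V : ℕ} (hs : s + m < L.length)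
    (hm : m ≤ V + 1) (hV : 1 ≤ V) :
    2 ^ (moved (fun r => L.getD (s + r) 0) m).ncard ≤ 4 * V := by
  rcases Nat.lt_or_ge (4 * V) (2 ^ d) with h | h
  · set n := Nat.clog 2 (V + 1) with hn
    have h1 : V + 1 ≤ 2 ^ n := Nat.le_pow_clog (by norm_num) _
    have h2 : 2 ^ n.pred < V + 1 := Nat.pow_pred_clog_lt_self (by norm_num) (by omega)
    have hn1 : n ≠ 0 := by
      intro h0
      rw [h0] at h1
      omega
    obtain ⟨c, hc⟩ := Nat.exists_eq_succ_of_ne_zero hn1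
    rw [hc] at h1 h2
    simp only [Nat.pred_succ] at h2
    have h3 : 2 ^ (c + 2) < 2 ^ d := by rw [pow_add]; omega
    have hnd : c + 2 < d := (Nat.pow_lt_pow_iff_right (by norm_num)).1 h3
    have h4 : 2 ^ (c + 1) < 2 ^ d := Nat.pow_lt_pow_right (by norm_num) (by omega)
    -- A window of `2 ^ (c + 1)` edges that starts at `s` may overrun the curve; it is then moved
    -- back to end at the last vertex and still covers the section.
    have h5 := hL.ncard_moved (n := c + 1) (s := min s (L.length - 1 - 2 ^ (c + 1))) (by omega)
      (by omega)
    have h6 := Set.ncard_le_ncard (moved_shift_subset (v := fun i => L.getD i 0)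
      (s := s) (s' := min s (L.length - 1 - 2 ^ (c + 1))) (m := m) (m' := 2 ^ (c + 1))
      (by omega) (by rw [Nat.succ_eq_add_one] at h1; omega))
    refine (Nat.pow_le_pow_right (by norm_num) (h6.trans h5.le)).trans ?_
    rw [pow_add]
    omega
  · exact (Nat.pow_le_pow_right (by norm_num) (ncard_le_dim _)).trans h

theorem IsGrayBlock.fitsInBox {d : ℕ} {v : ℕ → Vertex d} {m : ℕ} {w : Vertex d}
    (h : IsGrayBlock v m w) {lo hi V : ℕ} (hlo : 2 ^ d * m ≤ lo) (hhi : hi < 2 ^ d * (m + 1))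
    (hT : 2 ^ (moved (fun r => v (lo + r)) (hi - lo)).ncard ≤ 4 * V) :
    FitsInBox (v '' Icc lo hi) V := by
  classical
  refine ⟨fun j => if j ∈ moved (fun r => v (lo + r)) (hi - lo) then 2 else 1, fun j => ?_,
    by rwa [prod_ite_two_eq]⟩
  dsimp only
  split_ifs with hj
  · refine ⟨2 * w j, ?_⟩
    rintro _ ⟨i, ⟨h1, h2⟩, rfl⟩
    have := h.mem (i - 2 ^ d * m) (by rw [Nat.mul_succ] at hhi; omega) j
    rw [Nat.add_sub_cancel' (by omega)] at this
    omega
  · refine ⟨v lo j, ?_⟩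
    rintro _ ⟨i, ⟨h1, h2⟩, rfl⟩
    have := eq_of_notMem_moved hj (r := i - lo) (by omega)
    simp only [Nat.add_sub_cancel' h1, Nat.add_zero] at this
    omega

theorem adjacentBlocks_of_isGrayBlock {d : ℕ} {v : ℕ → Vertex d} {m : ℕ} {w w' : Vertex d}
    (h : IsGrayBlock v m w) (h' : IsGrayBlock v (m + 1) w') (hw : IsEdge w w') {e : Direction d}
    (hv : v (2 ^ d * (m + 1)) = v (2 ^ d * m + (2 ^ d - 1)) + e.vec) :
    AdjacentBlocks (fun r => v (2 ^ d * m + (2 ^ d - 1 - r))) (fun r => v (2 ^ d * (m + 1) + r))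
      w w' e.1 := by
  have hD : 0 < 2 ^ d := by positivity
  have hdir : ∀ (e : Direction d) (j : Fin d), (j ≠ e.1 → e.vec j = 0) ∧
      (j = e.1 → e.vec j = 1 ∨ e.vec j = -1) := fun e j => by
    refine ⟨fun hj => by simp [Direction.vec, hj], ?_⟩
    rintro rfl
    rcases Int.units_eq_one_or e.2 with h | h <;> simp [Direction.vec, h]
  obtain ⟨e', he'⟩ := hw
  have hv' : ∀ j, v (2 ^ d * (m + 1)) j = v (2 ^ d * m + (2 ^ d - 1)) j + e.vec j :=
    fun j => congrFun hv j
  have hw' : ∀ j, w' j = w j + e'.vec j := fun j => congrFun he' j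
  have hmem : ∀ j, v (2 ^ d * m + (2 ^ d - 1)) j = 2 * w j ∨ _ := h.mem (2 ^ d - 1) (by omega)
  have hmem' : ∀ j, v (2 ^ d * (m + 1)) j = 2 * w' j ∨ _ := h'.mem 0 hD
  -- Along the axis of `e'` the two cubes have disjoint coordinate ranges, so the connecting edge
  -- has to change that coordinate.
  have hee : e'.1 = e.1 := by
    by_contra hne
    have h1 := (hdir e e'.1).1 hne
    have h2 := (hdir e' e'.1).2 rfl
    have h3 := hv' e'.1
    have h4 := hw' e'.1
    have h5 := hmem e'.1
    have h6 := hmem' e'.1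
    simp only [Nat.add_zero] at h6
    omega
  refine ⟨fun r hr j => h.mem _ (by omega) j, h'.mem, fun j hj => ?_, ?_, fun j hj => ?_, ?_⟩
  · have h1 := (hdir e' j).1 (hee ▸ hj)
    have := hw' j
    omega
  · have h1 := (hdir e' e.1).2 hee.symm
    have := hw' e.1
    omega
  · have h1 := (hdir e j).1 hj
    have := hv' j
    simp only [Nat.sub_zero, Nat.add_zero]
    omega
  · have h1 := (hdir e e.1).2 rfl
    have := hv' e.1
    simp only [Nat.sub_zero, Nat.add_zero]
    omega

theorem moved₂_eq_moved {d : ℕ} {v : ℕ → Vertex d} {m p q : ℕ} {e : Direction d}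
    (hv : v (2 ^ d * (m + 1)) = v (2 ^ d * m + (2 ^ d - 1)) + e.vec) (hp : p < 2 ^ d) :
    moved₂ (fun r => v (2 ^ d * m + (2 ^ d - 1 - r))) (fun r => v (2 ^ d * (m + 1) + r)) e.1 p q =
      moved (fun r => v (2 ^ d * m + (2 ^ d - 1 - p) + r)) (p + q + 1) := by
  have hD : 2 ^ d * (m + 1) = 2 ^ d * m + 2 ^ d := Nat.mul_succ _ _
  have he : ∀ j, v (2 ^ d * m + (2 ^ d - 1)) j ≠ v (2 ^ d * (m + 1)) j ↔ j = e.1 := fun j => by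
    rw [hv]
    exact ne_add_vec_iff _ _ _
  ext j
  constructor
  · rintro (hj | ⟨r, hr, hne⟩ | ⟨r, hr, hne⟩)
    · refine ⟨p, by omega, ?_⟩
      have h1 : 2 ^ d * m + (2 ^ d - 1 - p) + p = 2 ^ d * m + (2 ^ d - 1) := by omega
      have h2 : 2 ^ d * m + (2 ^ d - 1 - p) + (p + 1) = 2 ^ d * (m + 1) := by omega
      simp only [h1, h2]
      exact (he j).2 hj
    · refine ⟨p - r - 1, by omega, ?_⟩
      have h1 : 2 ^ d * m + (2 ^ d - 1 - p) + (p - r - 1) =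
        2 ^ d * m + (2 ^ d - 1 - (r + 1)) := by omega
      have h2 : 2 ^ d * m + (2 ^ d - 1 - p) + (p - r - 1 + 1) =
        2 ^ d * m + (2 ^ d - 1 - r) := by omega
      simp only [h1, h2]
      exact hne.symm
    · refine ⟨p + r + 1, by omega, ?_⟩
      have h1 : 2 ^ d * m + (2 ^ d - 1 - p) + (p + r + 1) = 2 ^ d * (m + 1) + r := by omega
      have h2 : 2 ^ d * m + (2 ^ d - 1 - p) + (p + r + 1 + 1) =
        2 ^ d * (m + 1) + (r + 1) := by omega
      simp only [h1, h2]
      exact hne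
  · rintro ⟨r, hr, hne⟩
    rcases lt_trichotomy r p with h | rfl | h
    · refine Or.inr (Or.inl ⟨p - r - 1, by omega, ?_⟩)
      have h1 : 2 ^ d * m + (2 ^ d - 1 - p) + r =
        2 ^ d * m + (2 ^ d - 1 - (p - r - 1 + 1)) := by omega
      have h2 : 2 ^ d * m + (2 ^ d - 1 - p) + (r + 1) =
        2 ^ d * m + (2 ^ d - 1 - (p - r - 1)) := by omega
      simp only [h1, h2] at hne
      exact hne.symm
    · have h1 : 2 ^ d * m + (2 ^ d - 1 - r) + r = 2 ^ d * m + (2 ^ d - 1) := by omega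
      have h2 : 2 ^ d * m + (2 ^ d - 1 - r) + (r + 1) = 2 ^ d * (m + 1) := by omega
      simp only [h1, h2] at hne
      exact Or.inl ((he j).1 hne)
    · refine Or.inr (Or.inr ⟨r - p - 1, by omega, ?_⟩)
      have h1 : 2 ^ d * m + (2 ^ d - 1 - p) + r = 2 ^ d * (m + 1) + (r - p - 1) := by omega
      have h2 : 2 ^ d * m + (2 ^ d - 1 - p) + (r + 1) =
        2 ^ d * (m + 1) + (r - p - 1 + 1) := by omega
      simp only [h1, h2] at hne
      exact hne

theorem FitsInBox.mono {d : ℕ} {s t : Set (Vertex d)} {V : ℕ} (h : FitsInBox t V) (hst : s ⊆ t) :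
    FitsInBox s V := by
  obtain ⟨n, hn, hV⟩ := h
  refine ⟨n, fun j => ?_, hV⟩
  obtain ⟨l, hl⟩ := hn j
  exact ⟨l, fun v hv => hl v (hst hv)⟩

/-- A section of at most `V + 2` vertices of a hyperorthogonal well-folded curve that lies in two
subsequent blocks of `2 ^ d` vertices fits in a box that contains at most `4 * V` vertices. -/
theorem WellFolded.fitsInBox {d : ℕ} (hd : 1 ≤ d) {L : List (Vertex d)} (hL : WellFolded L)
    (hH : Hyperorthogonal L) {lo hi c V : ℕ} (hle : lo ≤ hi) (hhi : hi < L.length)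
    (hV : 1 ≤ V) (hVhi : hi ≤ lo + V + 1) (hc : 2 ^ d * c ≤ lo + 2 ^ d)
    (hc' : hi < 2 ^ d * (c + 1)) : FitsInBox ((fun i => L.getD i 0) '' Icc lo hi) V := by
  rcases eq_or_ne L.length 1 with h1 | h1
  -- A single vertex has no block structure, and is too short for the bound on the number of axes.
  · refine ⟨fun _ => 1, fun j => ⟨L.getD 0 0 j, ?_⟩, by simp; omega⟩
    rintro _ ⟨i, ⟨-, hi⟩, rfl⟩
    obtain rfl : i = 0 := by omega
    simp
  obtain ⟨M, w, hM, hblock, hedge⟩ := hL.exists_blocks h1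
  have hD : 0 < 2 ^ d := by positivity
  have hlen : 2 ^ d ≤ L.length := by
    rw [hM]
    refine Nat.le_mul_of_pos_right _ (Nat.pos_of_ne_zero ?_)
    rintro rfl
    omega
  have hT := hH.two_pow_ncard_moved_le hlen (s := lo) (m := hi - lo) (V := V) (by omega) (by omega)
    hV
  rcases le_or_gt (2 ^ d * c) lo with h2 | h2
  · refine (hblock c ?_).fitsInBox h2 hc' hT
    by_contra! hMc
    have := Nat.mul_le_mul_left (2 ^ d) hMc
    omega
  obtain ⟨m, rfl⟩ : ∃ m, c = m + 1 := Nat.exists_eq_succ_of_ne_zero (by rintro rfl; omega)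
  have hDm : 2 ^ d * (m + 1) = 2 ^ d * m + 2 ^ d := Nat.mul_succ _ _
  have hDm' : 2 ^ d * (m + 1 + 1) = 2 ^ d * (m + 1) + 2 ^ d := Nat.mul_succ _ _
  rcases Nat.lt_or_ge hi (2 ^ d * (m + 1)) with h3 | h3
  · refine (hblock m ?_).fitsInBox (by omega) h3 hT
    by_contra! hMc
    have := Nat.mul_le_mul_left (2 ^ d) hMc
    omega
  have hmM : m + 1 < M := by
    by_contra! hMc
    have := Nat.mul_le_mul_left (2 ^ d) hMc
    omega
  have hb := hblock m (by omega)
  have hb' := hblock (m + 1) hmM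
  obtain ⟨e, he⟩ := List.isChain_iff_getElem.1 hL.isCurve.2 (2 ^ d * m + (2 ^ d - 1)) (by omega)
  have hv : L.getD (2 ^ d * (m + 1)) 0 = L.getD (2 ^ d * m + (2 ^ d - 1)) 0 + e.vec := by
    rw [List.getD_eq_getElem _ _ (by omega), List.getD_eq_getElem _ _ (by omega), ← he]
    congr 1
    omega
  have hadj := adjacentBlocks_of_isGrayBlock hb hb' (hedge m hmM) hv
  -- The earlier block is read backward, so that both sequences start at the connecting edge.
  obtain ⟨πα, hα⟩ := hb.backward
  obtain ⟨πβ, hβ⟩ := hb'.forward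
  have hlo' : 2 ^ d * m + (2 ^ d - 1 - (2 ^ d * (m + 1) - 1 - lo)) = lo := by omega
  refine (hadj.fitsInBox hd hα hβ ?_ (p := 2 ^ d * (m + 1) - 1 - lo) (q := hi - 2 ^ d * (m + 1))
    (by omega) (by omega) (by omega) hV ?_).mono ?_
  · rintro c rfl p q hpq
    have hc4 : 2 ^ (c + 2) = 2 ^ c * 4 := by rw [pow_add]; norm_num
    rw [moved₂_eq_moved (v := fun i => L.getD i 0) hv (by omega), hpq]
    have hMM := Nat.mul_le_mul_left (2 ^ (c + 2)) (show m + 1 + 1 ≤ M from hmM)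
    exact hH.ncard_moved le_rfl (by omega)
  · rw [moved₂_eq_moved (v := fun i => L.getD i 0) hv (by omega), hlo']
    convert hT using 4
    omega
  · rintro _ ⟨i, ⟨h4, h5⟩, rfl⟩
    rcases Nat.lt_or_ge i (2 ^ d * (m + 1)) with h6 | h6
    · refine Or.inl ⟨2 ^ d * (m + 1) - 1 - i, by omega, ?_⟩
      have : 2 ^ d * m + (2 ^ d - 1 - (2 ^ d * (m + 1) - 1 - i)) = i := by omega
      simp only [this]
    · refine Or.inr ⟨i - 2 ^ d * (m + 1), by omega, ?_⟩
      have : 2 ^ d * (m + 1) + (i - 2 ^ d * (m + 1)) = i := by omega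
      simp only [this]

/-! ### Volumes -/

theorem volume_boundingBox_le {d k V : ℕ} {S : Set (Fin d → ℝ)} {s : Set (Vertex d)}
    (hS : S ⊆ ⋃ v ∈ s, cell k v) (hs : FitsInBox s V) :
    volume (boundingBox S) ≤ 4 * (V * ENNReal.ofReal (1 / 2 ^ k) ^ d) := by
  obtain ⟨n, hn, hV⟩ := hs
  choose l hl using hn
  have hk : (0 : ℝ) < 2 ^ k := by positivity
  have hsub : S ⊆ Icc (fun j => (l j : ℝ) / 2 ^ k) fun j => ((l j : ℝ) + n j) / 2 ^ k := by
    intro x hx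
    obtain ⟨v, hv, hxv⟩ := mem_iUnion₂.1 (hS hx)
    refine ⟨fun j => le_trans ?_ (hxv.1 j), fun j => (hxv.2 j).trans ?_⟩
    · have : (l j : ℝ) ≤ v j := by exact_mod_cast (hl j v hv).1
      dsimp only
      gcongr
    · have : (v j : ℝ) + 1 ≤ l j + n j := by exact_mod_cast (hl j v hv).2
      dsimp only
      gcongr
  have hbox : boundingBox S ⊆ Icc (fun j => (l j : ℝ) / 2 ^ k) fun j => ((l j : ℝ) + n j) / 2 ^ k :=
    iInter_subset_of_subset _ (iInter_subset_of_subset _ (iInter_subset _ hsub))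
  refine (measure_mono hbox).trans ?_
  rw [Real.volume_Icc_pi]
  have : ∀ j, ENNReal.ofReal (((l j : ℝ) + n j) / 2 ^ k - (l j : ℝ) / 2 ^ k) =
      n j * ENNReal.ofReal (1 / 2 ^ k) := fun j => by
    rw [← ENNReal.ofReal_natCast, ← ENNReal.ofReal_mul (by positivity)]
    congr 1
    ring
  simp only [this, Finset.prod_mul_distrib, Finset.prod_const, Finset.card_univ, Fintype.card_fin]
  rw [← mul_assoc]
  gcongr
  exact_mod_cast hV

/-- Closed cells share faces; the half-open ones are disjoint and have the same volume. -/
theorem le_volume_of_cells {d k : ℕ} {S : Set (Fin d → ℝ)} {s : Finset (Vertex d)}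
    (hS : ∀ v ∈ s, cell k v ⊆ S) :
    s.card * ENNReal.ofReal (1 / 2 ^ k) ^ d ≤ volume S := by
  have hk : (0 : ℝ) < 2 ^ k := by positivity
  let h : Vertex d → Set (Fin d → ℝ) := fun v =>
    Set.univ.pi fun j => Ico ((v j : ℝ) / 2 ^ k) (((v j : ℝ) + 1) / 2 ^ k)
  have hsub : ⋃ v ∈ s, h v ⊆ S := iUnion₂_subset fun v hv x hx =>
    hS v hv ⟨fun j => (hx j (mem_univ j)).1, fun j => (hx j (mem_univ j)).2.le⟩
  have hdisj : (s : Set (Vertex d)).PairwiseDisjoint h := by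
    intro v _ w _ hvw
    refine Set.disjoint_left.2 fun x hx hx' => hvw (funext fun j => ?_)
    obtain ⟨h1, h2⟩ := hx j (mem_univ j)
    obtain ⟨h3, h4⟩ := hx' j (mem_univ j)
    rw [div_le_iff₀ hk] at h1 h3
    rw [lt_div_iff₀ hk] at h2 h4
    have h5 : v j < w j + 1 := by exact_mod_cast h1.trans_lt h4
    have h6 : w j < v j + 1 := by exact_mod_cast h3.trans_lt h2
    omega
  refine le_trans (le_of_eq ?_) (measure_mono hsub)
  rw [measure_biUnion_finset hdisj fun v _ =>
    MeasurableSet.univ_pi fun j => measurableSet_Ico]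
  have : ∀ v, volume (h v) = ENNReal.ofReal (1 / 2 ^ k) ^ d := fun v => by
    rw [Real.volume_pi_Ico]
    have : ∀ j, ((v j : ℝ) + 1) / 2 ^ k - (v j : ℝ) / 2 ^ k = 1 / 2 ^ k := fun j => by ring
    simp [this]
  simp [this]

/-! ### Cells that cover a section and cells contained in it -/

theorem Approximates.length_eq {d : ℕ} {A : ℕ → List (Vertex d)} {f : ℝ → Fin d → ℝ}
    (hA : Approximates A f) (k : ℕ) : (A k).length = 2 ^ (d * k) := by
  induction k with
  | zero => simp [hA.zero]
  | succ k ih =>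
    obtain ⟨Cs, hCs⟩ := hA.succ k
    rw [hCs.length_eq, ih]
    ring

theorem Approximates.image_subset {d : ℕ} {A : ℕ → List (Vertex d)} {f : ℝ → Fin d → ℝ}
    (hA : Approximates A f) (k : ℕ) {a b : ℝ} (ha : 0 ≤ a) (hb : b ≤ 1) :
    f '' Icc a b ⊆ ⋃ v ∈ (fun i => (A k).getD i 0) ''
      Icc (⌈a * 2 ^ (d * k)⌉₊ - 1) (min ⌊b * 2 ^ (d * k)⌋₊ (2 ^ (d * k) - 1)), cell k v := by
  rintro _ ⟨t, ⟨h1, h2⟩, rfl⟩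
  have hlen := hA.length_eq k
  have hN : (0 : ℝ) < 2 ^ (d * k) := by positivity
  have hN' : 0 < 2 ^ (d * k) := by positivity
  -- The minimum assigns the final time `t = 1` to the last cell.
  set i := min ⌊t * 2 ^ (d * k)⌋₊ (2 ^ (d * k) - 1) with hi
  have hiN : i < (A k).length := by omega
  have ht0 : 0 ≤ t * 2 ^ (d * k) := mul_nonneg (ha.trans h1) hN.le
  have hlo : ⌈a * 2 ^ (d * k)⌉₊ - 1 ≤ i := by
    have e1 : ⌈a * 2 ^ (d * k)⌉₊ ≤ ⌊a * 2 ^ (d * k)⌋₊ + 1 := Nat.ceil_le_floor_add_one _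
    have e2 : ⌊a * 2 ^ (d * k)⌋₊ ≤ ⌊t * 2 ^ (d * k)⌋₊ := by gcongr
    have e3 : ⌈a * 2 ^ (d * k)⌉₊ ≤ 2 ^ (d * k) := by
      refine Nat.ceil_le.2 ?_
      push_cast
      exact mul_le_of_le_one_left hN.le (h1.trans (h2.trans hb))
    omega
  have hhi : i ≤ min ⌊b * 2 ^ (d * k)⌋₊ (2 ^ (d * k) - 1) := by
    have e2 : ⌊t * 2 ^ (d * k)⌋₊ ≤ ⌊b * 2 ^ (d * k)⌋₊ := by gcongr
    omega
  refine mem_iUnion₂.2 ⟨_, ⟨i, ⟨hlo, hhi⟩, rfl⟩, ?_⟩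
  dsimp only
  rw [List.getD_eq_getElem _ _ hiN, ← hA.traverse k i hiN]
  refine mem_image_of_mem f ⟨?_, ?_⟩
  · rw [div_le_iff₀ hN]
    exact le_trans (Nat.cast_le.2 (min_le_left _ _)) (Nat.floor_le ht0)
  · rw [le_div_iff₀ hN]
    rcases le_total ⌊t * 2 ^ (d * k)⌋₊ (2 ^ (d * k) - 1) with h | h
    · rw [hi, min_eq_left h]
      exact (Nat.lt_floor_add_one _).le
    · rw [hi, min_eq_right h]
      have : ((2 ^ (d * k) - 1 : ℕ) : ℝ) + 1 = 2 ^ (d * k) := by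
        rw [Nat.cast_sub hN']
        push_cast
        ring
      rw [this]
      exact mul_le_of_le_one_left hN.le (h2.trans hb)

theorem Approximates.le_volume_image {d : ℕ} {A : ℕ → List (Vertex d)} {f : ℝ → Fin d → ℝ}
    (hA : Approximates A f) {k : ℕ} (hnodup : (A k).Nodup) {a b : ℝ} (hb0 : 0 ≤ b) (hb : b ≤ 1) :
    ((⌊b * 2 ^ (d * k)⌋₊ - ⌈a * 2 ^ (d * k)⌉₊ : ℕ) : ENNReal) * ENNReal.ofReal (1 / 2 ^ k) ^ d ≤
      volume (f '' Icc a b) := by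
  have hlen := hA.length_eq k
  have hN : (0 : ℝ) < 2 ^ (d * k) := by positivity
  have hy : ⌊b * 2 ^ (d * k)⌋₊ ≤ 2 ^ (d * k) := by
    refine Nat.floor_le_of_le ?_
    push_cast
    exact mul_le_of_le_one_left hN.le hb
  let I := Finset.Ico ⌈a * 2 ^ (d * k)⌉₊ ⌊b * 2 ^ (d * k)⌋₊
  have hcard : (I.image fun i => (A k).getD i 0).card =
      ⌊b * 2 ^ (d * k)⌋₊ - ⌈a * 2 ^ (d * k)⌉₊ := by
    rw [Finset.card_image_of_injOn, Nat.card_Ico]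
    intro i hi j hj hij
    have hi' := Finset.mem_Ico.1 (Finset.mem_coe.1 hi)
    have hj' := Finset.mem_Ico.1 (Finset.mem_coe.1 hj)
    dsimp only at hij
    rw [List.getD_eq_getElem _ _ (by omega), List.getD_eq_getElem _ _ (by omega)] at hij
    exact (hnodup.getElem_inj_iff).1 hij
  rw [← hcard]
  refine le_volume_of_cells fun v hv => ?_
  obtain ⟨i, hi, rfl⟩ := Finset.mem_image.1 hv
  obtain ⟨h1, h2⟩ := Finset.mem_Ico.1 hi
  rw [List.getD_eq_getElem _ _ (by omega), ← hA.traverse k i (by omega)]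
  refine image_mono (Icc_subset_Icc ?_ ?_)
  · rw [le_div_iff₀ hN]
    exact Nat.ceil_le.1 h1
  · rw [div_le_iff₀ hN]
    have : ((i + 1 : ℕ) : ℝ) ≤ ⌊b * 2 ^ (d * k)⌋₊ := by exact_mod_cast h2
    push_cast at this
    exact this.trans (Nat.floor_le (mul_nonneg hb0 hN.le))

/-! ### Choice of the level -/

theorem exists_ceil_lt_floor {d : ℕ} (hd : 1 ≤ d) {a b : ℝ} (ha : 0 ≤ a) (hab : a < b) :
    ∃ k : ℕ, ⌈a * 2 ^ (d * k)⌉₊ < ⌊b * 2 ^ (d * k)⌋₊ := by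
  obtain ⟨k, hk⟩ := pow_unbounded_of_one_lt (2 / (b - a)) (show (1 : ℝ) < 2 by norm_num)
  refine ⟨k, ?_⟩
  have h1 : (2 : ℝ) ^ k ≤ 2 ^ (d * k) :=
    pow_le_pow_right₀ (by norm_num) (Nat.le_mul_of_pos_left k hd)
  have h2 := hk.trans_le h1
  rw [div_lt_iff₀ (by linarith)] at h2
  have hN : (0 : ℝ) < 2 ^ (d * k) := by positivity
  have h3 := Nat.ceil_lt_add_one (mul_nonneg ha hN.le)
  have h4 := Nat.lt_floor_add_one (b * 2 ^ (d * k))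
  have : (⌈a * 2 ^ (d * k)⌉₊ : ℝ) < ⌊b * 2 ^ (d * k)⌋₊ := by nlinarith
  exact_mod_cast this

/-- At the first level at which a section contains a full cell, it meets at most two subsequent
blocks of `D` cells. -/
theorem ceil_floor_block_bounds {D N : ℕ} (hD : 0 < D) {a b : ℝ} (hb0 : 0 ≤ b)
    (h : ⌊b * N⌋₊ ≤ ⌈a * N⌉₊) :
    D * ⌈a * N⌉₊ ≤ ⌈a * (D * N)⌉₊ - 1 + D ∧ ⌊b * (D * N)⌋₊ < D * (⌈a * N⌉₊ + 1) := by
  have hD' : (0 : ℝ) < D := by exact_mod_cast hD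
  constructor
  · rcases Nat.eq_zero_or_pos ⌈a * N⌉₊ with h0 | h0
    · simp [h0]
    · obtain ⟨c, hc⟩ := Nat.exists_eq_succ_of_ne_zero h0.ne'
      have h1 : (c : ℝ) < a * N := Nat.lt_ceil.1 (by omega)
      have h2 : D * c < ⌈a * (D * N)⌉₊ := by
        refine Nat.lt_ceil.2 ?_
        push_cast
        nlinarith
      rw [hc, Nat.mul_succ]
      omega
  · rw [Nat.floor_lt (by positivity)]
    have h1 : b * N < ⌊b * N⌋₊ + 1 := Nat.lt_floor_add_one _
    have h2 : (⌊b * N⌋₊ : ℝ) ≤ ⌈a * N⌉₊ := by exact_mod_cast h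
    push_cast
    nlinarith

end GridCurve

theorem mainTheorem1 (d : ℕ) (hd : 1 ≤ d) (f : ℝ → Fin d → ℝ)
    (hf : GridCurve.IsSpaceFillingCurve f)
    (A : ℕ → List (GridCurve.Vertex d)) (hA : GridCurve.Approximates A f)
    (hwell : ∀ k, GridCurve.WellFolded (A k))
    (hortho : ∀ k, GridCurve.Hyperorthogonal (A k))
    (a b : ℝ) (ha : 0 ≤ a) (hab : a < b) (hb : b ≤ 1) :
    0 < volume (f '' Icc a b) ∧ GridCurve.boxToCurveRatio (f '' Icc a b) ≤ 4 := by
  classical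
  have hb0 : 0 ≤ b := ha.trans hab.le
  have hex := GridCurve.exists_ceil_lt_floor hd ha hab
  obtain ⟨k, hk, hmin⟩ : ∃ k : ℕ, ⌈a * 2 ^ (d * k)⌉₊ < ⌊b * 2 ^ (d * k)⌋₊ ∧
      ∀ m < k, ¬ ⌈a * 2 ^ (d * m)⌉₊ < ⌊b * 2 ^ (d * m)⌋₊ :=
    ⟨Nat.find hex, Nat.find_spec hex, fun m hm => Nat.find_min hex hm⟩
  have hy : ⌊b * 2 ^ (d * k)⌋₊ ≤ 2 ^ (d * k) := by
    refine Nat.floor_le_of_le ?_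
    push_cast
    exact mul_le_of_le_one_left (by positivity) hb
  have hlen := hA.length_eq k
  have hblock : ∃ c, 2 ^ d * c ≤ ⌈a * 2 ^ (d * k)⌉₊ - 1 + 2 ^ d ∧
      min ⌊b * 2 ^ (d * k)⌋₊ (2 ^ (d * k) - 1) < 2 ^ d * (c + 1) := by
    -- Level 0 has one cell and no previous level; at later levels, minimality says that the
    -- previous level has no whole interval in `[a, b]`.
    cases k with
    | zero => exact ⟨0, by simp⟩
    | succ k =>
      have h := GridCurve.ceil_floor_block_bounds (D := 2 ^ d) (N := 2 ^ (d * k)) (a := a) (b := b)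
        (by positivity) hb0 (by simpa using hmin k (by omega))
      have hp : (((2 ^ d : ℕ) : ℝ) * ((2 ^ (d * k) : ℕ) : ℝ)) = 2 ^ (d * (k + 1)) := by
        push_cast
        ring
      rw [hp] at h
      exact ⟨_, h.1, (min_le_left _ _).trans_lt h.2⟩
  obtain ⟨c, hc, hc'⟩ := hblock
  have hvol := hA.le_volume_image (hwell k).isCurve.1 (a := a) hb0 hb
  have hfit := (hwell k).fitsInBox hd (hortho k)
    (V := ⌊b * 2 ^ (d * k)⌋₊ - ⌈a * 2 ^ (d * k)⌉₊) (by omega) (by omega) (by omega) (by omega)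
    hc hc'
  have hbox := GridCurve.volume_boundingBox_le (hA.image_subset k ha hb) hfit
  -- The same volume of `V` cells bounds the section from below and, times 4, its box from above.
  refine ⟨lt_of_lt_of_le ?_ hvol, ENNReal.div_le_of_le_mul (hbox.trans (by gcongr))⟩
  refine ENNReal.mul_pos ?_ (pow_ne_zero _ ?_)
  · exact_mod_cast (by omega : ⌊b * 2 ^ (d * k)⌋₊ - ⌈a * 2 ^ (d * k)⌉₊ ≠ 0)
  · exact (ENNReal.ofReal_pos.2 (by positivity)).ne'
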